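/- For a positive integer $n$ and a graph $H$, let $AR(n,H)$ (the anti-Ramsey number) be the maximum number of colors that can occur in an edge-coloring (not necessarily proper) of the complete graph $K_n$ containing no rainbow copy of $H$, i.e. no subgraph isomorphic to $H$ whose edges receive pairwise distinct colors. Let $P_\ell$ denote the path on $\ell$ vertices, let $mG$ denote the disjoint union of $m$ copies of a graph $G$, and let $G\cup G'$ denote the disjoint union of $G$ and $G'$. Theorem. Let $k$, $t$, $n$ be integers with $k\ge 1$, $t\ge 1$ and $n=4k+2t$. Then \[ AR(n,\,kP_4\cup tP_2)=AR(n,\,(2k+t)P_2). \] -/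

import Mathlib

namespace AntiRamsey

/-- The disjoint union `m G` of `m` copies of the graph `G`; copy `i` has the vertices `(i, v)`. -/
def copies {V : Type*} (m : ℕ) (G : SimpleGraph V) : SimpleGraph (Fin m × V) where
  Adj p q := p.1 = q.1 ∧ G.Adj p.2 q.2
  symm := ⟨fun _ _ h => ⟨h.1.symm, h.2.symm⟩⟩
  loopless := ⟨fun _ h => G.irrefl h.2⟩

/-- The edge-coloring `c` of the complete graph on `Fin n` has a rainbow copy of `H`: some copy of
`H` in that graph whose edges receive pairwise distinct colors. -/
def HasRainbowCopy {V : Type*} {n : ℕ} (c : SimpleGraph.TopEdgeLabeling (Fin n) ℕ)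
    (H : SimpleGraph V) : Prop :=
  ∃ f : SimpleGraph.Copy H (⊤ : SimpleGraph (Fin n)), 
    Function.Injective fun e : H.edgeSet => c (f.toHom.mapEdgeSet e)

/-- The numbers of colors that occur in an edge-coloring of the complete graph on `n` vertices
without a rainbow copy of `H`. Only finitely many colors occur, so they may be natural numbers. -/
def colorCounts {V : Type*} (n : ℕ) (H : SimpleGraph V) : Set ℕ :=
  {r | ∃ c : SimpleGraph.TopEdgeLabeling (Fin n) ℕ,
    ¬ HasRainbowCopy c H ∧ (Set.range c).ncard = r}

/-- The anti-Ramsey number `AR(n, H)`: the maximum number of colors in an edge-coloring of the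
complete graph on `n` vertices without a rainbow copy of `H`. -/
noncomputable def AR {V : Type*} (n : ℕ) (H : SimpleGraph V) : ℕ :=
  sSup (colorCounts n H)

/-- The supremum in the definition of `AR n H` is a maximum when `H` has two or more edges. -/
theorem isGreatest_AR {V : Type*} (n : ℕ) (H : SimpleGraph V) (hH : H.edgeSet.Nontrivial) :
    IsGreatest (colorCounts n H) (AR n H) := by
  have hb : BddAbove (colorCounts n H) := by
    refine ⟨Nat.card (⊤ : SimpleGraph (Fin n)).edgeSet, ?_⟩
    rintro r ⟨c, -, rfl⟩
    rw [← Nat.card_coe_set_eq]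
    exact Finite.card_range_le c
  have hn : (colorCounts n H).Nonempty := by
    refine ⟨_, fun _ => 0, ?_, rfl⟩
    rintro ⟨f, hf⟩
    obtain ⟨a, ha, b, hb, hab⟩ := hH
    exact hab (congrArg Subtype.val (@hf ⟨a, ha⟩ ⟨b, hb⟩ rfl))
  exact ⟨Nat.sSup_mem hn hb, fun r hr => le_csSup hb hr⟩

/-- The path `P_l` on `l` vertices. -/
abbrev P (l : ℕ) : SimpleGraph (Fin l) := SimpleGraph.pathGraph l

end AntiRamsey

/-! Write `m = 2k + t`, so `n = 2m`. Since `m P₂` is a subgraph of `k P₄ ∪ t P₂`, a coloring without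
a rainbow matching has no rainbow path forest; this gives `≥`. For `≤`, suppose a coloring without a
rainbow path forest has more than `AR n (m P₂)` colors. It then has a rainbow perfect matching `M`.
The clique coloring on `n - 3` vertices shows that at least `2m² - 7m + 8` colors occur, so at least
`2(m - 2)²` of them are absent from `M`. Pick an edge of each such color; it joins two edges of `M`.
Let `R` be the graph on the edges of `M` recording these joins. Each pair carries at most four
chosen edges, so the degree sum of `R` is at least `(m - 2)²`, and
`SimpleGraph.exists_isMatchingPair` finds `k` disjoint edges in `R`, as `2k + 1 ≤ m`. Each merges
two edges of `M` into a rainbow `P₄`, a contradiction. -/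

/-! ### Matchings in dense graphs -/

open Finset in
theorem Finset.card_filter_add_card_filter_le {α : Type*} [DecidableEq α] (U : Finset α)
    (hU : 2 ≤ #U) (p q : α → Prop) [DecidablePred p] [DecidablePred q]
    (h : ∀ u ∈ U, ∀ v ∈ U, u ≠ v → ¬ (p u ∧ q v)) :
    #(U.filter p) + #(U.filter q) ≤ #U := by
  rcases (U.filter p).eq_empty_or_nonempty with hp | ⟨u, hu⟩
  · rw [hp, card_empty, zero_add]
    exact card_filter_le _ _
  rcases (U.filter q).eq_empty_or_nonempty with hq | ⟨v, hv⟩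
  · rw [hq, card_empty, add_zero]
    exact card_filter_le _ _
  rw [mem_filter] at hu hv
  -- With both classes nonempty, each has at most one element; `2 ≤ #U` absorbs the two.
  have h1 : U.filter q ⊆ {u} := fun w hw => by
    rw [mem_filter] at hw
    by_contra hne
    exact h u hu.1 w hw.1 (fun e => hne (by simp [e])) ⟨hu.2, hw.2⟩
  have h2 : U.filter p ⊆ {v} := fun w hw => by
    rw [mem_filter] at hw
    by_contra hne
    exact h w hw.1 v hv.1 (fun e => hne (by simp [e])) ⟨hw.2, hv.2⟩
  have := card_le_card h1
  have := card_le_card h2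
  simp only [card_singleton] at *
  omega

/-- A matching with `j` edges, given by its pairs of end vertices. -/
def SimpleGraph.IsMatchingPair {α : Type*} (R : SimpleGraph α) {j : ℕ} (a b : Fin j → α) : Prop :=
  Function.Injective (Sum.elim a b) ∧ ∀ i, R.Adj (a i) (b i)

namespace SimpleGraph.IsMatchingPair

variable {α : Type*} {R : SimpleGraph α} {j : ℕ} {a b : Fin j → α}

theorem cons (h : R.IsMatchingPair a b) {x y : α} (hxy : R.Adj x y)
    (hx : x ∉ Set.range (Sum.elim a b)) (hy : y ∉ Set.range (Sum.elim a b)) :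
    R.IsMatchingPair (Fin.cons x a : Fin (j + 1) → α) (Fin.cons y b : Fin (j + 1) → α) := by
  obtain ⟨hi, hadj⟩ := h
  have hne := hxy.ne
  rw [Sum.elim_injective] at hi
  simp only [Set.mem_range, Sum.exists, Sum.elim_inl, Sum.elim_inr, not_or, not_exists] at hx hy
  refine ⟨?_, ?_⟩
  · rw [Sum.elim_injective]
    refine ⟨?_, ?_, ?_⟩
    · exact Fin.cons_injective_iff.2 ⟨by simpa using hx.1, hi.1⟩
    · exact Fin.cons_injective_iff.2 ⟨by simpa using hy.2, hi.2.1⟩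
    · intro i l
      refine Fin.cases ?_ (fun i => ?_) i <;> refine Fin.cases ?_ (fun l => ?_) l
      · simpa using hne
      · simpa using fun e => hx.2 l e.symm
      · simpa using hy.1 i
      · simpa using hi.2.2 i l
  · intro i
    refine Fin.cases ?_ (fun i => ?_) i
    · simpa using hxy
    · simpa using hadj i

/-- Followed by `cons`, this performs the augmentation along a path `u, a i, b i, v`. -/
theorem update (h : R.IsMatchingPair a b) {i : Fin j} {u : α} (hu : R.Adj (a i) u)
    (hx : u ∉ Set.range (Sum.elim a b)) :
    R.IsMatchingPair a (Function.update b i u) := by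
  obtain ⟨hi, hadj⟩ := h
  rw [Sum.elim_injective] at hi
  simp only [Set.mem_range, Sum.exists, Sum.elim_inl, Sum.elim_inr, not_or, not_exists] at hx
  refine ⟨?_, ?_⟩
  · rw [Sum.elim_injective]
    refine ⟨hi.1, ?_, ?_⟩
    · intro l l' e
      by_cases h1 : l = i <;> by_cases h2 : l' = i <;>
        simp [h1, h2] at e ⊢
      · exact (hx.2 _ e.symm).elim
      · exact (hx.2 _ e).elim
      · exact hi.2.1 e
    · intro l l'
      by_cases h2 : l' = i
      · simpa [h2] using hx.1 l
      · simpa [h2] using hi.2.2 l l'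
  · intro l
    by_cases h2 : l = i
    · subst h2; simpa using hu
    · simpa [h2] using hadj l

/-- A matching that misses three vertices can be enlarged if the graph has many edges. -/
theorem exists_succ [Fintype α] [DecidableEq α] [DecidableRel R.Adj] (h : R.IsMatchingPair a b)
    (hj : 2 * j + 3 ≤ Fintype.card α)
    (hR : Fintype.card α ^ 2 + 4 ≤ 4 * Fintype.card α + ∑ v, R.degree v) :
    ∃ a' b' : Fin (j + 1) → α, R.IsMatchingPair a' b' := by
  by_contra hno
  set U : Finset α := Finset.univ.filter (· ∉ Set.range (Sum.elim a b))
  have hmU : ∀ {x}, x ∈ U ↔ x ∉ Set.range (Sum.elim a b) := by simp [U]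
  have hsplit : ∀ f : α → ℕ, ∑ v, f v = ∑ i, (f (a i) + f (b i)) + ∑ u ∈ U, f u := by
    intro f
    rw [← Finset.sum_filter_add_sum_filter_not Finset.univ (· ∉ Set.range (Sum.elim a b)), add_comm]
    congr 1
    have : Finset.univ.filter (fun x => ¬ x ∉ Set.range (Sum.elim a b)) =
        Finset.univ.image (Sum.elim a b) := by ext; simp [or_iff_not_imp_left]
    rw [this, Finset.sum_image h.1.injOn, Fintype.sum_sum_type, Finset.sum_add_distrib]
    simp
  have hcard : Fintype.card α = 2 * j + U.card := by
    have := hsplit (fun _ => 1)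
    simp at this
    omega
  have hind : ∀ u ∈ U, ∀ v ∈ U, ¬ R.Adj u v := fun u hu v hv huv =>
    hno ⟨_, _, h.cons huv (hmU.1 hu) (hmU.1 hv)⟩
  -- There is no augmenting path of length three.
  have haug : ∀ i, ∀ u ∈ U, ∀ v ∈ U, u ≠ v → ¬ (R.Adj (a i) u ∧ R.Adj (b i) v) := by
    rintro i u hu v hv huv ⟨h1, h2⟩
    have hu' := hmU.1 hu
    have hv' := hmU.1 hv
    have hi := h.1
    rw [Sum.elim_injective] at hi
    refine hno ⟨_, _, (h.update h1 hu').cons h2 ?_ ?_⟩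
    · simp only [Set.mem_range, Sum.exists, Sum.elim_inl, Sum.elim_inr, not_or, not_exists] at hu' ⊢
      refine ⟨fun l => hi.2.2 l i, fun l e => ?_⟩
      by_cases hl : l = i
      · subst hl
        exact hu'.2 l (by simpa using e.symm)
      · exact hl (hi.2.1 (by simpa [hl] using e))
    · simp only [Set.mem_range, Sum.exists, Sum.elim_inl, Sum.elim_inr, not_or, not_exists] at hv' ⊢
      refine ⟨hv'.1, fun l e => ?_⟩
      by_cases hl : l = i
      · subst hl
        exact huv (by simpa using e)
      · exact hv'.2 l (by simpa [hl] using e)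
  let d : α → ℕ := fun v => (U.filter (R.Adj v)).card
  have hdeg : ∀ v, R.degree v = ∑ w, if R.Adj v w then 1 else 0 := fun v => by
    rw [Finset.sum_boole, ← R.card_neighborFinset_eq_degree, R.neighborFinset_eq_filter]
    simp
  have hdU : ∀ v, ∑ u ∈ U, (if R.Adj v u then 1 else 0) = d v := fun v => by
    simp [d]
  have hle : ∀ v w : α, (if R.Adj v w then 1 else 0) ≤ 1 := fun v w => by split <;> simp
  -- The `-1` comes from `a i` not being adjacent to itself.
  have hda : ∀ i, R.degree (a i) ≤ 2 * j - 1 + d (a i) := by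
    intro i
    have h1 : (∑ l, ((if R.Adj (a i) (a l) then 1 else 0) +
        (if R.Adj (a i) (b l) then 1 else 0))) < ∑ _l : Fin j, 2 :=
      Finset.sum_lt_sum (fun l _ => add_le_add (hle _ _) (hle _ _))
        ⟨i, Finset.mem_univ _, by simp; split <;> simp⟩
    rw [hdeg, hsplit, hdU]
    simp only [Finset.sum_const, Finset.card_univ, Fintype.card_fin, smul_eq_mul] at h1
    omega
  have hdb : ∀ i, R.degree (b i) ≤ 2 * j - 1 + d (b i) := by
    intro i
    have h1 : (∑ l, ((if R.Adj (b i) (a l) then 1 else 0) +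
        (if R.Adj (b i) (b l) then 1 else 0))) < ∑ _l : Fin j, 2 :=
      Finset.sum_lt_sum (fun l _ => add_le_add (hle _ _) (hle _ _))
        ⟨i, Finset.mem_univ _, by simp; split <;> simp⟩
    rw [hdeg, hsplit, hdU]
    simp only [Finset.sum_const, Finset.card_univ, Fintype.card_fin, smul_eq_mul] at h1
    omega
  have hab : ∀ i, d (a i) + d (b i) ≤ U.card := fun i =>
    Finset.card_filter_add_card_filter_le U (by omega) _ _ (haug i)
  have hUdeg : ∑ u ∈ U, R.degree u = ∑ i, (d (a i) + d (b i)) := by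
    have : ∀ u ∈ U, R.degree u =
        ∑ i, ((if R.Adj (a i) u then 1 else 0) + (if R.Adj (b i) u then 1 else 0)) := by
      intro u hu
      rw [hdeg, hsplit, Finset.sum_eq_zero (s := U) fun v hv => if_neg (hind u hu v hv), add_zero]
      simp only [R.adj_comm u]
    rw [Finset.sum_congr rfl this, Finset.sum_comm]
    refine Finset.sum_congr rfl fun i _ => ?_
    rw [Finset.sum_add_distrib, hdU, hdU]
  have htot : ∑ v, R.degree v ≤ ∑ _i : Fin j, (2 * (2 * j - 1) + 2 * U.card) := by
    rw [hsplit, hUdeg, ← Finset.sum_add_distrib]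
    refine Finset.sum_le_sum fun i _ => ?_
    have := hda i
    have := hdb i
    have := hab i
    omega
  simp only [Finset.sum_const, Finset.card_univ, Fintype.card_fin, smul_eq_mul] at htot
  rw [hcard] at hR hj
  rcases Nat.eq_zero_or_pos j with rfl | hpos
  · nlinarith
  · obtain ⟨s, hs⟩ : ∃ s, 2 * j - 1 = s ∧ 2 * j = s + 1 := ⟨_, rfl, by omega⟩
    rw [hs.1] at htot
    -- With `u = |U|`, the gap `(2j + u - 2)² - 2j(2j - 1 + u)` equals `2j(u - 3) + (u - 2)²`,
    -- positive once `u ≥ 3`.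
    obtain ⟨w, hw⟩ := Nat.exists_eq_add_of_le (show 3 ≤ U.card by omega)
    rw [hw, hs.2] at hR
    rw [hw] at htot
    nlinarith [hs.2]

end SimpleGraph.IsMatchingPair

theorem SimpleGraph.exists_isMatchingPair {α : Type*} [Fintype α] [DecidableEq α]
    (R : SimpleGraph α) [DecidableRel R.Adj]
    (hR : Fintype.card α ^ 2 + 4 ≤ 4 * Fintype.card α + ∑ v, R.degree v)
    (k : ℕ) (hk : 2 * k + 1 ≤ Fintype.card α) :
    ∃ a b : Fin k → α, R.IsMatchingPair a b := by
  induction k with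
  | zero => exact ⟨Fin.elim0, Fin.elim0, fun x => by rcases x with x | x <;> exact x.elim0,
      fun x => x.elim0⟩
  | succ j ih =>
    obtain ⟨a, b, h⟩ := ih (by omega)
    exact h.exists_succ (by omega) hR

/-! ### Rainbow copies -/

namespace AntiRamsey

variable {V : Type*} {n : ℕ}

/-- The coloring `c` as a function on all unordered pairs, with value `0` on the diagonal. -/
noncomputable def pairColor (c : SimpleGraph.TopEdgeLabeling (Fin n) ℕ) (e : Sym2 (Fin n)) : ℕ :=
  open Classical in if h : e ∈ (⊤ : SimpleGraph (Fin n)).edgeSet then c ⟨e, h⟩ else 0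

theorem pairColor_coe (c : SimpleGraph.TopEdgeLabeling (Fin n) ℕ)
    (e : (⊤ : SimpleGraph (Fin n)).edgeSet) : pairColor c e = c e :=
  dif_pos e.2

theorem pairColor_map_coe (c : SimpleGraph.TopEdgeLabeling (Fin n) ℕ) {H : SimpleGraph V}
    (f : SimpleGraph.Copy H (⊤ : SimpleGraph (Fin n))) (e : H.edgeSet) :
    pairColor c (e.1.map f) = c (f.toHom.mapEdgeSet e) :=
  pairColor_coe c (f.toHom.mapEdgeSet e)

/-- Reduces rainbowness to any convenient indexed family of pairs covering the edges. -/
theorem hasRainbowCopy_of_injective {c : SimpleGraph.TopEdgeLabeling (Fin n) ℕ} {H : SimpleGraph V}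
    {f : V → Fin n} (hf : Function.Injective f) {ι : Type*} (g : ι → Sym2 V)
    (hg : ∀ v w, H.Adj v w → ∃ i, g i = s(v, w))
    (hinj : Function.Injective fun i => pairColor c ((g i).map f)) : HasRainbowCopy c H := by
  let F : SimpleGraph.Copy H (⊤ : SimpleGraph (Fin n)) :=
    ⟨⟨f, fun h => fun e => h.ne (hf e)⟩, hf⟩
  refine ⟨F, fun e e' he => ?_⟩
  have he' : pairColor c (e.1.map F) = pairColor c (e'.1.map F) := by
    rw [pairColor_map_coe, pairColor_map_coe]; exact he
  have hg' : ∀ e ∈ H.edgeSet, ∃ i, g i = e := by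
    intro e
    induction e with
    | _ v w => exact hg v w
  obtain ⟨i, hi⟩ := hg' e.1 e.2
  obtain ⟨i', hi'⟩ := hg' e'.1 e'.2
  rw [← hi, ← hi'] at he'
  have := hinj he'
  subst this
  exact Subtype.ext (hi.symm.trans hi')

theorem HasRainbowCopy.of_copy {W : Type*} {c : SimpleGraph.TopEdgeLabeling (Fin n) ℕ}
    {G : SimpleGraph V} {H : SimpleGraph W} (h : HasRainbowCopy c H) (g : SimpleGraph.Copy G H) :
    HasRainbowCopy c G := by
  obtain ⟨f, hf⟩ := h
  refine ⟨f.comp g, fun e e' he => g.mapEdgeSet.injective (hf ?_)⟩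
  have key : ∀ e : G.edgeSet, (f.comp g).toHom.mapEdgeSet e =
      f.toHom.mapEdgeSet (g.toHom.mapEdgeSet e) := by
    rintro ⟨e, h⟩
    apply Subtype.ext
    induction e with
    | _ v w => rfl
  simp only [key] at he
  exact he

theorem copies_two_adj_iff {m : ℕ} {p q : Fin m × Fin 2} :
    (copies m (P 2)).Adj p q ↔ p.1 = q.1 ∧ p.2 ≠ q.2 := by
  simp [copies, SimpleGraph.pathGraph_two_eq_top]

theorem HasRainbowCopy.exists_equiv {m : ℕ} (hn : n = 2 * m)
    {c : SimpleGraph.TopEdgeLabeling (Fin n) ℕ} (h : HasRainbowCopy c (copies m (P 2))) :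
    ∃ φ : Fin m × Fin 2 ≃ Fin n,
      Function.Injective fun i : Fin m => pairColor c s(φ (i, 0), φ (i, 1)) := by
  obtain ⟨f, hf⟩ := h
  -- The matching is spanning.
  have hb : Function.Bijective f := by
    rw [Fintype.bijective_iff_injective_and_card]
    exact ⟨f.injective, by simp [hn]; ring⟩
  refine ⟨Equiv.ofBijective f hb, fun i i' he => ?_⟩
  have hadj : ∀ i : Fin m, s((i, 0), (i, 1)) ∈ (copies m (P 2)).edgeSet := fun i =>
    copies_two_adj_iff.2 ⟨rfl, by simp⟩
  have := @hf ⟨_, hadj i⟩ ⟨_, hadj i'⟩ (by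
    simp only [← pairColor_map_coe]
    exact he)
  have := congrArg Subtype.val this
  simp at this
  exact this

/-! ### Lower bound from the clique coloring -/

/-- The coloring that is rainbow on the first `s` vertices and uses one color elsewhere. -/
noncomputable def cliqueColoring (n s : ℕ) : SimpleGraph.TopEdgeLabeling (Fin n) ℕ :=
  fun e => open Classical in
    if ∀ v ∈ e.1, v.1 < s then Encodable.encode (Fintype.equivFin (Sym2 (Fin n)) e.1) + 1 else 0

theorem cliqueColoring_eq_zero {s : ℕ} {e : (⊤ : SimpleGraph (Fin n)).edgeSet} {v : Fin n}
    (hv : v ∈ e.1) (hs : s ≤ v) : cliqueColoring n s e = 0 :=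
  if_neg fun h => absurd (h v hv) (not_lt.2 hs)

theorem choose_succ_le_ncard_range_cliqueColoring {s : ℕ} (h0 : 0 < s) (hs : s < n) :
    s.choose 2 + 1 ≤ (Set.range (cliqueColoring n s)).ncard := by
  classical
  let S : Finset (Fin n) := Finset.univ.filter (fun v => v.1 < s)
  have hS : S.card = s := by simp [S, Fin.card_filter_val_lt, hs.le]
  let code : Sym2 (Fin n) → ℕ := fun e => Encodable.encode (Fintype.equivFin (Sym2 (Fin n)) e) + 1
  have hcode : Function.Injective code := fun e e' h => by simpa [code] using h
  let A : Finset ℕ := insert 0 ((S.offDiag.image Sym2.mk.uncurry).image code)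
  have hA : A.card = s.choose 2 + 1 := by
    rw [Finset.card_insert_of_notMem (by simp [code]), Finset.card_image_of_injective _ hcode,
      Sym2.card_image_offDiag, hS]
  rw [← hA, ← Set.ncard_coe_finset]
  refine Set.ncard_le_ncard ?_ (Set.finite_range _)
  intro x hx
  simp only [A, Finset.coe_insert, Finset.coe_image, Set.mem_insert_iff, Set.mem_image,
    Finset.mem_coe, Finset.mem_offDiag, Prod.exists] at hx
  rcases hx with rfl | ⟨e, ⟨p, q, ⟨hp, hq, hpq⟩, rfl⟩, rfl⟩
  · refine ⟨⟨s(⟨0, by omega⟩, ⟨s, hs⟩), ?_⟩, cliqueColoring_eq_zero (v := ⟨s, hs⟩) (by simp) le_rfl⟩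
    rw [SimpleGraph.mem_edgeSet, SimpleGraph.top_adj, ne_eq, Fin.mk.injEq]
    omega
  · refine ⟨⟨s(p, q), hpq⟩, if_pos ?_⟩
    simp only [S, Finset.mem_filter, Finset.mem_univ, true_and] at hp hq
    simp [hp, hq]

theorem not_hasRainbowCopy_cliqueColoring {m s : ℕ} (hn : n = 2 * m) (hs : s + 3 ≤ n) :
    ¬ HasRainbowCopy (cliqueColoring n s) (copies m (P 2)) := by
  intro h
  obtain ⟨φ, hφ⟩ := h.exists_equiv hn
  have hzero : ∀ i (w : Fin 2), s ≤ (φ (i, w)).1 →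
      pairColor (cliqueColoring n s) s(φ (i, 0), φ (i, 1)) = 0 := by
    intro i w hw
    have hne : s(φ (i, 0), φ (i, 1)) ∈ (⊤ : SimpleGraph (Fin n)).edgeSet := by simp
    refine (pairColor_coe _ ⟨_, hne⟩).trans (cliqueColoring_eq_zero (v := φ (i, w)) ?_ hw)
    fin_cases w <;> simp
  -- Three vertices outside the clique all lie on matching edges of color `0`. A rainbow matching
  -- has only one such edge, with only two ends.
  let g : Fin 3 → Fin 2 := fun x => (φ.symm ⟨s + x, by omega⟩).2
  have hg : Function.Injective g := by
    intro x y hxy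
    have h1 : ∀ x : Fin 3, pairColor (cliqueColoring n s)
        s(φ ((φ.symm ⟨s + x, by omega⟩).1, 0), φ ((φ.symm ⟨s + x, by omega⟩).1, 1)) = 0 :=
      fun x => hzero _ (φ.symm ⟨s + x, by omega⟩).2 (by simp)
    have h2 := hφ ((h1 x).trans (h1 y).symm)
    have h3 := φ.symm.injective (Prod.ext h2 hxy)
    rw [Fin.mk.injEq] at h3
    omega
  simpa using Fintype.card_le_of_injective g hg

theorem bddAbove_colorCounts (n : ℕ) (H : SimpleGraph V) : BddAbove (colorCounts n H) := by
  refine ⟨Nat.card (⊤ : SimpleGraph (Fin n)).edgeSet, ?_⟩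
  rintro r ⟨c, -, rfl⟩
  rw [← Nat.card_coe_set_eq]
  exact Finite.card_range_le c

theorem choose_succ_le_AR_copies_two {m s : ℕ} (hn : n = 2 * m) (h0 : 0 < s) (hs : s + 3 ≤ n) :
    s.choose 2 + 1 ≤ AR n (copies m (P 2)) :=
  (choose_succ_le_ncard_range_cliqueColoring h0 (by omega)).trans <|
    le_csSup (bddAbove_colorCounts n _) ⟨_, not_hasRainbowCopy_cliqueColoring hn hs, rfl⟩

end AntiRamsey

/-! ### Connecting the edges of a rainbow matching -/

namespace AntiRamsey

/-- If a coloring of the pairs in `Fin m × Fin 2` has many colors besides those of the pairs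
`{(i, 0), (i, 1)}`, then `k` differently colored pairs with such colors join disjoint pairs of
indices. -/
theorem exists_connecting_pairs {m : ℕ} (col : Sym2 (Fin m × Fin 2) → ℕ) (C : Finset ℕ)
    (hC : ∀ x ∈ C, ∃ p q : Fin m × Fin 2, p ≠ q ∧ col s(p, q) = x)
    (hM : ∀ i, col s((i, 0), (i, 1)) ∉ C) (hcard : 2 * m ^ 2 + 8 ≤ C.card + 8 * m)
    (k : ℕ) (hk : 2 * k + 1 ≤ m) :
    ∃ p q : Fin k → Fin m × Fin 2,
      Function.Injective (Sum.elim (Prod.fst ∘ p) (Prod.fst ∘ q)) ∧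
      Function.Injective (fun i => col s(p i, q i)) ∧ ∀ i, col s(p i, q i) ∈ C := by
  classical
  have : NeZero m := ⟨by omega⟩
  choose! p q hpq hcol using hC
  have hfst : ∀ x ∈ C, (p x).1 ≠ (q x).1 := by
    intro x hx he
    refine hM (p x).1 ?_
    have : s((((p x).1, 0) : Fin m × Fin 2), ((p x).1, 1)) = s(p x, q x) := by
      have h1 := hpq x hx
      generalize p x = a at *
      generalize q x = b at *
      obtain ⟨i, v⟩ := a
      obtain ⟨i', w⟩ := b
      obtain rfl : i = i' := he
      fin_cases v <;> fin_cases w <;> simp at h1 ⊢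
    rw [this, hcol x hx]
    exact hx
  let R : SimpleGraph (Fin m) := SimpleGraph.fromRel fun i j => ∃ x ∈ C, (p x).1 = i ∧ (q x).1 = j
  have hR : ∀ i j, R.Adj i j ↔ ∃ x ∈ C, (p x).1 = i ∧ (q x).1 = j ∨ (p x).1 = j ∧ (q x).1 = i := by
    intro i j
    simp only [R, SimpleGraph.fromRel_adj]
    constructor
    · rintro ⟨-, ⟨x, hx, h⟩ | ⟨x, hx, h⟩⟩
      · exact ⟨x, hx, Or.inl h⟩
      · exact ⟨x, hx, Or.inr h⟩
    · rintro ⟨x, hx, ⟨rfl, rfl⟩ | ⟨rfl, rfl⟩⟩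
      · exact ⟨hfst x hx, Or.inl ⟨x, hx, rfl, rfl⟩⟩
      · exact ⟨(hfst x hx).symm, Or.inr ⟨x, hx, rfl, rfl⟩⟩
  have hdeg : C.card ≤ 2 * ∑ v, R.degree v := by
    have hD : Fintype.card {d : Fin m × Fin m // R.Adj d.1 d.2} = ∑ v, R.degree v := by
      rw [← R.dart_card_eq_sum_degrees]
      exact Fintype.card_congr ⟨fun d => ⟨d.1, d.2⟩, fun d => ⟨d.toProd, d.adj⟩,
        fun _ => rfl, fun _ => rfl⟩
    -- Each color, in both orientations, is encoded by a dart of `R` and the ends used: `2|C| ≤ 4 ∑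
    -- deg`.
    let F : C × Bool → {d : Fin m × Fin m // R.Adj d.1 d.2} × (Fin 2 × Fin 2) := fun x =>
      if x.2 then (⟨((p x.1).1, (q x.1).1), (hR _ _).2 ⟨x.1, x.1.2, Or.inl ⟨rfl, rfl⟩⟩⟩,
        ((p x.1).2, (q x.1).2))
      else (⟨((q x.1).1, (p x.1).1), (hR _ _).2 ⟨x.1, x.1.2, Or.inr ⟨rfl, rfl⟩⟩⟩,
        ((q x.1).2, (p x.1).2))
    have hF : Function.Injective F := by
      have hsym : ∀ x y : C, s(p x, q x) = s(p y, q y) → x = y := fun x y h =>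
        Subtype.ext ((hcol x x.2).symm.trans ((congrArg col h).trans (hcol y y.2)))
      rintro ⟨x, b⟩ ⟨y, b'⟩ h
      have hx := hfst x x.2
      have hmain : s(p x, q x) = s(p y, q y) := by
        rw [Sym2.eq_iff]
        cases b <;> cases b' <;> simp [F] at h <;> simp [Prod.ext_iff, h]
      obtain rfl := hsym x y hmain
      cases b <;> cases b' <;> simp [F] at h ⊢ <;> first | exact hx h.1.1 | exact hx h.1.1.symm
    have := Fintype.card_le_of_injective F hF
    rw [Fintype.card_prod, Fintype.card_prod, hD] at this
    simp at this
    omega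
  obtain ⟨a, b, hinj, hadj⟩ := R.exists_isMatchingPair (by rw [Fintype.card_fin]; omega) k (by simpa)
  have hch : ∀ i, ∃ x ∈ C, (p x).1 = a i ∧ (q x).1 = b i ∨ (p x).1 = b i ∧ (q x).1 = a i :=
    fun i => (hR _ _).1 (hadj i)
  choose x hxC hx using hch
  rw [Sum.elim_injective] at hinj
  have hxinj : Function.Injective x := by
    intro i j hij
    have h1 := hx i
    rw [hij] at h1
    rcases h1 with h1 | h1 <;> rcases hx j with h2 | h2
    · exact hinj.1 (h1.1.symm.trans h2.1)
    · exact (hinj.2.2 _ _ (h1.1.symm.trans h2.1)).elim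
    · exact (hinj.2.2 _ _ (h2.1.symm.trans h1.1)).elim
    · exact hinj.1 (h1.2.symm.trans h2.2)
  refine ⟨p ∘ x, q ∘ x, ?_, ?_, ?_⟩
  · rw [Sum.elim_injective]
    simp only [Function.comp_def]
    refine ⟨fun i j h => ?_, fun i j h => ?_, fun i j h => ?_⟩ <;>
      rcases hx i with h1 | h1 <;> rcases hx j with h2 | h2 <;>
      simp only [h1.1, h1.2, h2.1, h2.2] at h
    · exact hinj.1 h
    · exact (hinj.2.2 _ _ h).elim
    · exact (hinj.2.2 _ _ h.symm).elim
    · exact hinj.2.1 h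
    · exact hinj.2.1 h
    · exact (hinj.2.2 _ _ h.symm).elim
    · exact (hinj.2.2 _ _ h).elim
    · exact hinj.1 h
    · exact hinj.2.2 _ _ h
    · have := hinj.1 h
      subst this
      exact hinj.2.2 i i (h1.1.symm.trans h2.1)
    · have := hinj.2.1 h
      subst this
      exact hinj.2.2 i i (h2.1.symm.trans h1.1)
    · exact hinj.2.2 _ _ h.symm
  · intro i j h
    simp only [Function.comp_def, hcol _ (hxC _)] at h
    exact hxinj h
  · intro i
    simp only [Function.comp_def, hcol _ (hxC _)]
    exact hxC i

end AntiRamsey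

/-! ### Assembling the paths -/

namespace AntiRamsey

variable {n : ℕ}

theorem sym2_rev_left {m : ℕ} (v : Fin m × Fin 2) :
    s((v.1, v.2.rev), v) = s((v.1, 0), (v.1, 1)) := by
  obtain ⟨i, w⟩ := v
  fin_cases w <;> simp [Fin.rev]

/-- A rainbow perfect matching together with differently colored connecting edges gives a rainbow
copy of the disjoint union of paths on four and on two vertices. -/
theorem hasRainbowCopy_of_connecting_pairs {m k t : ℕ} (hm : m = 2 * k + t)
    (c : SimpleGraph.TopEdgeLabeling (Fin n) ℕ) (φ : Fin m × Fin 2 ≃ Fin n)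
    (hγ : Function.Injective fun i : Fin m => pairColor c (s((i, 0), (i, 1)).map φ))
    (p q : Fin k → Fin m × Fin 2)
    (hpq : Function.Injective (Sum.elim (Prod.fst ∘ p) (Prod.fst ∘ q)))
    (hcol : Function.Injective fun i => pairColor c (s(p i, q i).map φ))
    (hne : ∀ i j, pairColor c (s((j, 0), (j, 1)).map φ) ≠ pairColor c (s(p i, q i).map φ)) :
    HasRainbowCopy c (copies k (P 4) ⊕g copies t (P 2)) := by
  classical
  have hcard : (Finset.univ \ Finset.univ.image (Sum.elim (Prod.fst ∘ p) (Prod.fst ∘ q))).card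
      = t := by
    rw [Finset.card_univ_sdiff, Finset.card_image_of_injective _ hpq]
    simp
    omega
  let r : Fin t → Fin m := fun i => ((Finset.equivFinOfCardEq hcard).symm i).1
  have hr : Function.Injective r :=
    Subtype.val_injective.comp (Finset.equivFinOfCardEq hcard).symm.injective
  have hσ : Function.Injective (Sum.elim (Sum.elim (Prod.fst ∘ p) (Prod.fst ∘ q)) r) := by
    refine Sum.elim_injective.2 ⟨hpq, hr, fun x i h => ?_⟩
    have := ((Finset.equivFinOfCardEq hcard).symm i).2
    rw [Finset.mem_sdiff, Finset.mem_image] at this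
    exact this.2 ⟨x, Finset.mem_univ _, h⟩
  -- Each path runs: partner of `p`, `p`, `q`, partner of `q`; `rev` swaps the ends of a matching
  -- edge.
  let f : (Fin k × Fin 4) ⊕ (Fin t × Fin 2) → Fin m × Fin 2 := Sum.elim
    (fun x => ![((p x.1).1, (p x.1).2.rev), p x.1, q x.1, ((q x.1).1, (q x.1).2.rev)] x.2)
    (fun x => (r x.1, x.2))
  let index : (Fin k × Fin 4) ⊕ (Fin t × Fin 2) → (Fin k ⊕ Fin k) ⊕ Fin t := Sum.elim
    (fun x => ![.inl (.inl x.1), .inl (.inl x.1), .inl (.inr x.1), .inl (.inr x.1)] x.2)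
    (fun x => .inr x.1)
  have hfst : ∀ x, (f x).1 = Sum.elim (Sum.elim (Prod.fst ∘ p) (Prod.fst ∘ q)) r (index x) := by
    rintro (⟨i, w⟩ | ⟨i, w⟩)
    · fin_cases w <;> rfl
    · rfl
  have hrev : ∀ w : Fin 2, w.rev ≠ w := by decide
  have hf : Function.Injective f := by
    intro x y h
    have h1 : index x = index y := hσ (by rw [← hfst, ← hfst, h])
    rcases x with ⟨i, w⟩ | ⟨i, w⟩ <;> rcases y with ⟨j, w'⟩ | ⟨j, w'⟩
    · fin_cases w <;> fin_cases w' <;> simp [index] at h1 <;> subst h1 <;>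
        simp [f, Prod.ext_iff, hrev, (hrev _).symm] at h ⊢
    · fin_cases w <;> simp [index] at h1
    · fin_cases w' <;> simp [index] at h1
    · simp [index] at h1
      subst h1
      simpa [f] using h
  -- `inl` indexes edges of the perfect matching, `inr` the middle edges of the paths.
  let g : ((Fin k ⊕ Fin k) ⊕ Fin t) ⊕ Fin k → Sym2 ((Fin k × Fin 4) ⊕ (Fin t × Fin 2)) := Sum.elim
    (Sum.elim (Sum.elim (fun i => s(.inl (i, 0), .inl (i, 1))) fun i => s(.inl (i, 3), .inl (i, 2)))
      fun i => s(.inr (i, 0), .inr (i, 1))) fun i => s(.inl (i, 1), .inl (i, 2))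
  have hgl : ∀ x, (g (.inl x)).map f =
      s((Sum.elim (Sum.elim (Prod.fst ∘ p) (Prod.fst ∘ q)) r x, 0),
        (Sum.elim (Sum.elim (Prod.fst ∘ p) (Prod.fst ∘ q)) r x, 1)) := by
    rintro ((i | i) | i)
    · exact sym2_rev_left (p i)
    · exact sym2_rev_left (q i)
    · rfl
  have hgr : ∀ i, (g (.inr i)).map f = s(p i, q i) := fun i => rfl
  refine hasRainbowCopy_of_injective (φ.injective.comp hf) g ?_ ?_
  · rintro (⟨i, w⟩ | ⟨i, w⟩) (⟨j, w'⟩ | ⟨j, w'⟩) h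
    · obtain ⟨h1, h2⟩ : i = j ∧ (P 4).Adj w w' := h
      subst h1
      rw [SimpleGraph.pathGraph_adj] at h2
      have h3 : (w = 0 ∧ w' = 1 ∨ w = 1 ∧ w' = 0) ∨ (w = 1 ∧ w' = 2 ∨ w = 2 ∧ w' = 1) ∨
          (w = 2 ∧ w' = 3 ∨ w = 3 ∧ w' = 2) := by omega
      rcases h3 with (⟨rfl, rfl⟩ | ⟨rfl, rfl⟩) | (⟨rfl, rfl⟩ | ⟨rfl, rfl⟩) | (⟨rfl, rfl⟩ | ⟨rfl, rfl⟩)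
      · exact ⟨.inl (.inl (.inl i)), rfl⟩
      · exact ⟨.inl (.inl (.inl i)), Sym2.eq_swap⟩
      · exact ⟨.inr i, rfl⟩
      · exact ⟨.inr i, Sym2.eq_swap⟩
      · exact ⟨.inl (.inl (.inr i)), Sym2.eq_swap⟩
      · exact ⟨.inl (.inl (.inr i)), rfl⟩
    · simp at h
    · simp at h
    · obtain ⟨h1, h2⟩ := copies_two_adj_iff.1 (SimpleGraph.sum_adj_inr.1 h)
      obtain rfl : i = j := h1
      refine ⟨.inl (.inr i), ?_⟩
      have h3 : (w = 0 ∧ w' = 1) ∨ (w = 1 ∧ w' = 0) := by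
        have : w ≠ w' := h2
        omega
      rcases h3 with ⟨rfl, rfl⟩ | ⟨rfl, rfl⟩
      · rfl
      · exact Sym2.eq_swap
  · simp only [← Sym2.map_map]
    rintro (x | i) (y | j) h
    · simp only [hgl] at h
      exact congrArg _ (hσ (hγ h))
    · simp only [hgl, hgr] at h
      exact (hne _ _ h).elim
    · simp only [hgl, hgr] at h
      exact (hne _ _ h.symm).elim
    · simp only [hgr] at h
      exact congrArg _ (hcol h)

/-- The perfect matching in the disjoint union of paths on four and on two vertices. -/
theorem nonempty_copy_copies_two (k t : ℕ) :
    Nonempty (SimpleGraph.Copy (copies (2 * k + t) (P 2))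
      (copies k (P 4) ⊕g copies t (P 2))) := by
  have e : Fin (2 * k + t) ≃ (Fin k × Fin 2) ⊕ Fin t := Fintype.equivOfCardEq (by simp; ring)
  let f : Fin (2 * k + t) × Fin 2 → (Fin k × Fin 4) ⊕ (Fin t × Fin 2) := fun x =>
    -- `finProdFinEquiv` sends `(v, w)` to `2v + w`, so the outer edges `01` and `23` of each `P₄`
    -- are used.
    Sum.elim (fun y => .inl (y.1, finProdFinEquiv (y.2, x.2))) (fun y => .inr (y, x.2)) (e x.1)
  refine ⟨⟨⟨f, ?_⟩, ?_⟩⟩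
  · rintro ⟨i, w⟩ ⟨j, w'⟩ h
    obtain ⟨h1, h2⟩ := copies_two_adj_iff.1 h
    obtain rfl : i = j := h1
    have h2 : w ≠ w' := h2
    simp only [f]
    rcases e i with ⟨l, v⟩ | l
    · refine SimpleGraph.sum_adj_inl.2 ⟨rfl, ?_⟩
      rw [SimpleGraph.pathGraph_adj]
      simp [finProdFinEquiv]
      omega
    · exact SimpleGraph.sum_adj_inr.2 (copies_two_adj_iff.2 ⟨rfl, h2⟩)
  · rintro ⟨i, w⟩ ⟨j, w'⟩ h
    have key : e i = e j ∧ w = w' := by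
      change f _ = f _ at h
      simp only [f] at h
      generalize e i = x at h ⊢
      generalize e j = y at h ⊢
      rcases x with ⟨l, v⟩ | l <;> rcases y with ⟨l', v'⟩ | l' <;>
        simp only [Sum.elim_inl, Sum.elim_inr, Sum.inl.injEq, Sum.inr.injEq, Prod.mk.injEq,
          EmbeddingLike.apply_eq_iff_eq, reduceCtorEq] at h ⊢
      · exact ⟨⟨h.1, h.2.1⟩, h.2.2⟩
      · exact h
    exact Prod.ext (e.injective key.1) key.2

/-- A coloring with a rainbow perfect matching and many colors has a rainbow copy of
`k P₄ ∪ t P₂`. -/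
theorem hasRainbowCopy_paths_of_matching {k t m : ℕ} (ht : 1 ≤ t) (hm : m = 2 * k + t)
    (hn : n = 2 * m) (c : SimpleGraph.TopEdgeLabeling (Fin n) ℕ)
    (h : HasRainbowCopy c (copies m (P 2)))
    (hc : 2 * m ^ 2 + 8 ≤ (Set.range c).ncard + 7 * m) :
    HasRainbowCopy c (copies k (P 4) ⊕g copies t (P 2)) := by
  classical
  obtain ⟨φ, hφ⟩ := h.exists_equiv hn
  let col : Sym2 (Fin m × Fin 2) → ℕ := fun e => pairColor c (e.map φ)
  have hγ : Function.Injective fun i : Fin m => col s((i, 0), (i, 1)) := hφ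
  have hfin : (Set.range c).Finite := Set.finite_range _
  let C : Finset ℕ := hfin.toFinset \ Finset.univ.image fun i : Fin m => col s((i, 0), (i, 1))
  have hcard : (Set.range c).ncard ≤ C.card + m := by
    rw [Set.ncard_eq_toFinset_card _ hfin]
    refine Finset.card_le_card_sdiff_add_card.trans (Nat.add_le_add_left ?_ _)
    exact Finset.card_image_le.trans (by simp)
  obtain ⟨p, q, hpq, hinj, hC⟩ := exists_connecting_pairs col C (fun x hx => by
      obtain ⟨⟨e, he⟩, rfl⟩ := hfin.mem_toFinset.1 (Finset.mem_sdiff.1 hx).1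
      induction e with
      | _ v w =>
        refine ⟨φ.symm v, φ.symm w, fun h => he (φ.symm.injective h), ?_⟩
        simpa [col] using pairColor_coe c ⟨s(v, w), he⟩)
    (fun i hi => (Finset.mem_sdiff.1 hi).2 (Finset.mem_image_of_mem _ (Finset.mem_univ i)))
    (by omega) k (by omega)
  refine hasRainbowCopy_of_connecting_pairs hm c φ hγ p q hpq hinj fun i j h => ?_
  exact (Finset.mem_sdiff.1 (hC i)).2 (Finset.mem_image.2 ⟨j, Finset.mem_univ _, h⟩)

theorem edgeSet_copies_two_nontrivial {m : ℕ} (hm : 2 ≤ m) :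
    (copies m (P 2)).edgeSet.Nontrivial := by
  refine ⟨s((⟨0, by omega⟩, 0), (⟨0, by omega⟩, 1)), copies_two_adj_iff.2 ⟨rfl, by simp⟩,
    s((⟨1, by omega⟩, 0), (⟨1, by omega⟩, 1)), copies_two_adj_iff.2 ⟨rfl, by simp⟩, ?_⟩
  simp

end AntiRamsey

/-! ### The theorem -/

open SimpleGraph in
theorem theorem2 (k t n : ℕ) (hk : 1 ≤ k) (ht : 1 ≤ t) (hn : n = 4 * k + 2 * t) :
    AntiRamsey.AR n (AntiRamsey.copies k (AntiRamsey.P 4) ⊕g AntiRamsey.copies t (AntiRamsey.P 2)) =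
      AntiRamsey.AR n (AntiRamsey.copies (2 * k + t) (AntiRamsey.P 2)) := by
  obtain ⟨g⟩ := AntiRamsey.nonempty_copy_copies_two k t
  have hM := AntiRamsey.edgeSet_copies_two_nontrivial (m := 2 * k + t) (by omega)
  have hH : (AntiRamsey.copies k (AntiRamsey.P 4) ⊕g
      AntiRamsey.copies t (AntiRamsey.P 2)).edgeSet.Nontrivial := by
    obtain ⟨a, ha, b, hb, hab⟩ := hM
    exact ⟨_, (g.mapEdgeSet ⟨a, ha⟩).2, _, (g.mapEdgeSet ⟨b, hb⟩).2, fun h =>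
      hab (congrArg Subtype.val (g.mapEdgeSet.injective (Subtype.ext h)))⟩
  obtain ⟨hMmem, hMub⟩ := AntiRamsey.isGreatest_AR n _ hM
  obtain ⟨hHmem, hHub⟩ := AntiRamsey.isGreatest_AR n _ hH
  refine le_antisymm ?_ ?_
  · obtain ⟨c, hc, hr⟩ := hHmem
    by_contra! hlt
    have hrain : AntiRamsey.HasRainbowCopy c (AntiRamsey.copies (2 * k + t) (AntiRamsey.P 2)) := by
      by_contra h
      exact absurd (hMub ⟨c, h, hr⟩) (not_le.2 hlt)
    refine hc (AntiRamsey.hasRainbowCopy_paths_of_matching ht rfl (by omega) c hrain ?_)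
    have hlow := AntiRamsey.choose_succ_le_AR_copies_two (n := n) (m := 2 * k + t)
      (s := 2 * (2 * k + t) - 3) (by omega) (by omega) (by omega)
    obtain ⟨w, hw⟩ := Nat.exists_eq_add_of_le (show 3 ≤ 2 * k + t by omega)
    rw [hr]
    have hchoose : (2 * (2 * k + t) - 3).choose 2 = (2 * w + 3) * (w + 1) := by
      rw [hw, Nat.choose_two_right, show 2 * (3 + w) - 3 = 2 * w + 3 by omega,
        show 2 * w + 3 - 1 = (w + 1) * 2 by omega, ← mul_assoc, Nat.mul_div_cancel _ two_pos]
    rw [hchoose] at hlow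
    -- One color more than the clique coloring; with `m = w + 3` this is exactly `2m² - 7m + 8`.
    have : (2 * w + 3) * (w + 1) + 2 ≤ AntiRamsey.AR n (AntiRamsey.copies k (AntiRamsey.P 4) ⊕g
      AntiRamsey.copies t (AntiRamsey.P 2)) := by omega
    rw [hw]
    nlinarith
  · obtain ⟨c, hc, hr⟩ := hMmem
    exact hHub ⟨c, fun h => hc (h.of_copy g), hr⟩
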